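/- **Exponential concentration of data.** There is an absolute constant $C>0$ with the following property. Let $K\ge 1$ and $T\ge 1$ be integers, and let $X\in\mathbb{C}^{K\times T}$ be a random matrix whose entries $X_{k,t}$ are independent (not necessarily identically distributed), have zero mean, and are bounded, with $$\|X\|_\infty := \max_{k,t}\ \operatorname{ess\,sup}|X_{k,t}| = \frac{S_\infty}{\sqrt T},$$ and suppose that $\mathbb{E}[XX^{H}]=I_K$. Then for every $\delta>0$ with $T\ge C^2K/\delta^2$, $$\Pr\left[\frac{\|XX^{H}-I_K\|_F}{\sqrt K}\ \ge\ \frac{1}{\ln 2}\,S_\infty^2\max\{\delta,\delta^2\}\right]\ <\ 2\exp\left(-\Big(\frac{\delta\sqrt T}{C}-\sqrt K\Big)^2\right),$$ where $\|\cdot\|_F$ denotes the Frobenius norm and $X^{H}$ the conjugate transpose of $X$. -/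

import Mathlib

open MeasureTheory ProbabilityTheory
open scoped ENNReal Matrix Matrix.Norms.Frobenius

/-- The entrywise expectation `E[M]` of a random complex matrix `M`. -/
noncomputable def matrixExpectation {Ω m n : Type*} [MeasurableSpace Ω]
    (P : Measure Ω) (M : Ω → Matrix m n ℂ) : Matrix m n ℂ :=
  Matrix.of fun i j => ∫ ω, M ω i j ∂P

/-- The quantity `‖X‖_∞` of a random complex matrix `X`: the largest essential supremum of the
moduli of its entries, as an extended nonnegative real (it is `∞` if some entry is unbounded). -/
noncomputable def entrySupNorm {Ω m n : Type*} [MeasurableSpace Ω]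
    (P : Measure Ω) (X : Ω → Matrix m n ℂ) : ℝ≥0∞ :=
  ⨆ i : m, ⨆ j : n, eLpNorm (fun ω => X ω i j) ∞ P

/-!
The deviation `A = X Xᴴ - E[X Xᴴ]` is Hermitian, so `‖A‖_F ≤ √K ‖A‖` with `‖A‖` the operator norm,
and `‖A‖ ≤ 2 |⟪v, A v⟫|` for some `v` in any `1/2`-net of the unit sphere of `ℂᴷ`; there is a net
with at most `25 ^ K` points. For fixed `v` the quadratic form is the centred sum over the columns
`x_t` of the independent variables `|⟪v, x_t⟫|²`. These are squares of sub-Gaussian variables, hence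
sub-exponential, and Bernstein's inequality bounds the sum. A union bound over the net concludes;
the factor `25 ^ K` is absorbed because `δ √T / C ≥ √K`.
-/

section SubexponentialMGF

/-- A real random variable `X` is sub-exponential with variance proxy `c` on the window `[-b, b]` if
its moment generating function is dominated there by that of a centred Gaussian of variance `c`.
This is the class of variables for which Bernstein's inequality holds; `HasSubgaussianMGF` is the
analogous condition without the restriction to a window. -/
structure HasSubexponentialMGF {Ω : Type*} [MeasurableSpace Ω] (X : Ω → ℝ) (c b : ℝ)
    (P : Measure Ω) : Prop where
  integrable_exp_mul : ∀ t, |t| ≤ b → Integrable (fun ω => Real.exp (t * X ω)) P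
  mgf_le : ∀ t, |t| ≤ b → mgf X P t ≤ Real.exp (c * t ^ 2 / 2)

variable {Ω : Type*} [MeasurableSpace Ω] {P : Measure Ω}

namespace HasSubexponentialMGF

theorem sum_of_iIndepFun {ι : Type*} [Fintype ι] {X : ι → Ω → ℝ} {c : ι → ℝ} {b : ℝ}
    (hX : ∀ i, Measurable (X i)) (hind : iIndepFun X P)
    (h : ∀ i, HasSubexponentialMGF (X i) (c i) b P) :
    HasSubexponentialMGF (∑ i, X i) (∑ i, c i) b P where
  integrable_exp_mul t ht := by
    have := hind.isProbabilityMeasure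
    exact hind.integrable_exp_mul_sum hX fun i _ => (h i).integrable_exp_mul t ht
  mgf_le t ht := by
    rw [hind.mgf_sum hX, Finset.sum_mul, Finset.sum_div, Real.exp_sum]
    exact Finset.prod_le_prod (fun i _ => mgf_nonneg) fun i _ => (h i).mgf_le t ht

theorem measureReal_le_abs_le [IsFiniteMeasure P] {X : Ω → ℝ} {c b : ℝ}
    (h : HasSubexponentialMGF X c b P) (ε : ℝ) {t : ℝ} (ht0 : 0 ≤ t) (htb : t ≤ b) :
    P.real {ω | ε ≤ |X ω|} ≤ 2 * Real.exp (-t * ε + c * t ^ 2 / 2) := by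
  have htb' : |t| ≤ b := (abs_of_nonneg ht0).trans_le htb
  have upper : P.real {ω | ε ≤ X ω} ≤ Real.exp (-t * ε + c * t ^ 2 / 2) := by
    rw [Real.exp_add]
    exact (measure_ge_le_exp_mul_mgf ε ht0 (h.integrable_exp_mul t htb')).trans
      (mul_le_mul_of_nonneg_left (h.mgf_le t htb') (Real.exp_pos _).le)
  have lower : P.real {ω | X ω ≤ -ε} ≤ Real.exp (-t * ε + c * t ^ 2 / 2) := by
    rw [← abs_neg] at htb'
    rw [Real.exp_add, ← neg_sq t, ← neg_mul_neg (-t) ε]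
    exact (measure_le_le_exp_mul_mgf (-ε) (neg_nonpos.2 ht0)
      (h.integrable_exp_mul (-t) htb')).trans
        (mul_le_mul_of_nonneg_left (h.mgf_le (-t) htb') (Real.exp_pos _).le)
  have hcover : {ω | ε ≤ |X ω|} ⊆ {ω | ε ≤ X ω} ∪ {ω | X ω ≤ -ε} := by
    intro ω
    simp only [Set.mem_union, Set.mem_ofPred_eq, le_abs, le_neg, imp_self]
  linarith [(measureReal_mono hcover).trans (measureReal_union_le (μ := P) _ _)]

end HasSubexponentialMGF

theorem exp_mul_le_one_add_add_sq_mul_exp_abs {r : ℝ} (hr : |r| ≤ 1 / 2) (w : ℝ) :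
    Real.exp (r * w) ≤ 1 + r * w + 8 * r ^ 2 * Real.exp |w| := by
  have taylor : Real.exp (r * w) - (1 + r * w) ≤ (r * w) ^ 2 * Real.exp |r * w| := by
    have h := Complex.norm_exp_sub_sum_le_norm_mul_exp ((r * w : ℝ) : ℂ) 2
    have hcast : Complex.exp ((r * w : ℝ) : ℂ)
          - ∑ k ∈ Finset.range 2, ((r * w : ℝ) : ℂ) ^ k / k.factorial
        = ((Real.exp (r * w) - (1 + r * w) : ℝ) : ℂ) := by
      simp [Finset.sum_range_succ]
    rw [hcast, Complex.norm_real, Complex.norm_real, Real.norm_eq_abs, Real.norm_eq_abs,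
      sq_abs] at h
    exact (le_abs_self _).trans h
  have hexp : Real.exp |r * w| ≤ Real.exp (|w| / 2) := by
    rw [Real.exp_le_exp, abs_mul]
    nlinarith [abs_nonneg w]
  have hsq : w ^ 2 ≤ 8 * Real.exp (|w| / 2) := by
    have := Real.quadratic_le_exp_of_nonneg (x := |w| / 2) (by positivity)
    nlinarith [abs_nonneg w, sq_abs w]
  have remainder : (r * w) ^ 2 * Real.exp |r * w| ≤ 8 * r ^ 2 * Real.exp |w| := calc
    (r * w) ^ 2 * Real.exp |r * w|
      = r ^ 2 * w ^ 2 * Real.exp |r * w| := by rw [mul_pow]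
    _ ≤ r ^ 2 * (8 * Real.exp (|w| / 2)) * Real.exp (|w| / 2) := by gcongr
    _ = 8 * r ^ 2 * (Real.exp (|w| / 2) * Real.exp (|w| / 2)) := by ring
    _ = 8 * r ^ 2 * Real.exp |w| := by rw [← Real.exp_add, add_halves]
  linarith

theorem integrable_and_integral_le_of_lintegral_ofReal_le {f : Ω → ℝ}
    (hf : AEStronglyMeasurable f P) (hf0 : 0 ≤ f) {B : ℝ} (hB : 0 ≤ B)
    (h : ∫⁻ ω, ENNReal.ofReal (f ω) ∂P ≤ ENNReal.ofReal B) :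
    Integrable f P ∧ ∫ ω, f ω ∂P ≤ B := by
  refine ⟨(lintegral_ofReal_ne_top_iff_integrable hf (ae_of_all _ hf0)).1
    (ne_top_of_le_ne_top ENNReal.ofReal_ne_top h), ?_⟩
  rw [integral_eq_lintegral_of_nonneg_ae (ae_of_all _ hf0) hf]
  exact ENNReal.toReal_le_of_le_ofReal hB h

theorem integrable_of_integrable_exp_abs {U : Ω → ℝ} (hU : AEStronglyMeasurable U P)
    (h : Integrable (fun ω => Real.exp |U ω|) P) : Integrable U P :=
  h.mono' hU <| ae_of_all _ fun ω => by
    rw [Real.norm_eq_abs]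
    linarith [Real.add_one_le_exp |U ω|]

theorem hasSubexponentialMGF_of_integral_exp_abs_le [IsProbabilityMeasure P] {W : Ω → ℝ}
    (hW : Measurable W) (h0 : ∫ ω, W ω ∂P = 0)
    (hexp : Integrable (fun ω => Real.exp |W ω|) P) {B : ℝ} (hB : ∫ ω, Real.exp |W ω| ∂P ≤ B) :
    HasSubexponentialMGF W (16 * B) (1 / 2) P := by
  have hWi := integrable_of_integrable_exp_abs hW.aestronglyMeasurable hexp
  have hlin (r : ℝ) : Integrable (fun ω => 1 + r * W ω) P :=
    (integrable_const _).add (hWi.const_mul r)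
  have hmaj (r : ℝ) : Integrable (fun ω => 1 + r * W ω + 8 * r ^ 2 * Real.exp |W ω|) P :=
    (hlin r).add (hexp.const_mul _)
  have hint {r : ℝ} (hr : |r| ≤ 1 / 2) : Integrable (fun ω => Real.exp (r * W ω)) P :=
    (hmaj r).mono' (by fun_prop) <| ae_of_all _ fun ω => by
      rw [Real.norm_of_nonneg (Real.exp_pos _).le]
      exact exp_mul_le_one_add_add_sq_mul_exp_abs hr (W ω)
  refine ⟨fun r hr => hint hr, fun r hr => ?_⟩
  calc mgf W P r
      ≤ ∫ ω, (1 + r * W ω + 8 * r ^ 2 * Real.exp |W ω|) ∂P :=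
        integral_mono (hint hr) (hmaj r) fun ω => exp_mul_le_one_add_add_sq_mul_exp_abs hr (W ω)
    _ = 1 + 8 * r ^ 2 * ∫ ω, Real.exp |W ω| ∂P := by
        rw [integral_add (hlin r) (hexp.const_mul _),
          integral_add (integrable_const _) (hWi.const_mul r), integral_const_mul,
          integral_const_mul, h0, integral_const, probReal_univ, one_smul, mul_zero, add_zero]
    _ ≤ 1 + 8 * r ^ 2 * B := by gcongr
    _ = 16 * B * r ^ 2 / 2 + 1 := by ring
    _ ≤ Real.exp (16 * B * r ^ 2 / 2) := Real.add_one_le_exp _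

theorem hasSubexponentialMGF_sub_integral [IsProbabilityMeasure P] {U : Ω → ℝ}
    (hU : Measurable U) (hU0 : 0 ≤ U) (h2 : ∫⁻ ω, ENNReal.ofReal (Real.exp (U ω)) ∂P ≤ 2) :
    HasSubexponentialMGF (fun ω => U ω - ∫ ω', U ω' ∂P) 96 (1 / 2) P := by
  obtain ⟨hexp, hexp2⟩ := integrable_and_integral_le_of_lintegral_ofReal_le
    hU.exp.aestronglyMeasurable (fun ω => (Real.exp_pos _).le) zero_le_two (by simpa using h2)
  have hUi : Integrable U P := integrable_of_integrable_exp_abs hU.aestronglyMeasurable <| by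
    simpa only [abs_of_nonneg (hU0 _)] using hexp
  set μ := ∫ ω, U ω ∂P with hμ
  have hμ0 : 0 ≤ μ := integral_nonneg hU0
  have hμ1 : μ ≤ 1 := by
    have : ∫ ω, (U ω + 1) ∂P ≤ ∫ ω, Real.exp (U ω) ∂P :=
      integral_mono (hUi.add (integrable_const _)) hexp fun ω => Real.add_one_le_exp (U ω)
    rw [integral_add hUi (integrable_const _), integral_const, probReal_univ, one_smul] at this
    linarith
  have hdom (ω : Ω) : Real.exp |U ω - μ| ≤ Real.exp 1 * Real.exp (U ω) := by
    rw [← Real.exp_add, Real.exp_le_exp]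
    have : 0 ≤ U ω := hU0 ω
    exact abs_le.2 ⟨by linarith, by linarith⟩
  have hexp' : Integrable (fun ω => Real.exp |U ω - μ|) P :=
    (hexp.const_mul (Real.exp 1)).mono' (by fun_prop) <| ae_of_all _ fun ω => by
      rw [Real.norm_of_nonneg (Real.exp_pos _).le]
      exact hdom ω
  have hcentred : ∫ ω, (U ω - μ) ∂P = 0 := by
    rw [integral_sub hUi (integrable_const _), integral_const, probReal_univ, one_smul, hμ,
      sub_self]
  convert hasSubexponentialMGF_of_integral_exp_abs_le (hU.sub_const μ) hcentred hexp' (B := 6) ?_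
    using 1
  · norm_num
  · calc ∫ ω, Real.exp |U ω - μ| ∂P
        ≤ Real.exp 1 * ∫ ω, Real.exp (U ω) ∂P := by
          rw [← integral_const_mul]
          exact integral_mono hexp' (hexp.const_mul _) hdom
      _ ≤ 3 * 2 := by
          gcongr
          linarith [Real.exp_one_lt_d9]
      _ = 6 := by norm_num

end SubexponentialMGF

section SubgaussianSquare

variable {Ω : Type*} [MeasurableSpace Ω] {P : Measure Ω}

theorem lintegral_exp_sq_div_four_gaussianReal_le_two :
    ∫⁻ g, ENNReal.ofReal (Real.exp (g ^ 2 / 4)) ∂(gaussianReal 0 1) ≤ 2 := by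
  have hdensity (g : ℝ) : (gaussianPDF 0 1 * fun g => ENNReal.ofReal (Real.exp (g ^ 2 / 4))) g
      = ENNReal.ofReal ((√(2 * Real.pi))⁻¹ * Real.exp (-(1 / 4) * g ^ 2)) := by
    rw [Pi.mul_apply, gaussianPDF, gaussianPDFReal, ← ENNReal.ofReal_mul (by positivity), mul_assoc,
      ← Real.exp_add, NNReal.coe_one]
    ring_nf
  rw [gaussianReal_of_var_ne_zero _ one_ne_zero,
    lintegral_withDensity_eq_lintegral_mul _ (measurable_gaussianPDF _ _) (by fun_prop)]
  simp_rw [hdensity]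
  rw [← ofReal_integral_eq_lintegral_ofReal
    ((integrable_exp_neg_mul_sq (by norm_num)).const_mul _) (ae_of_all _ fun g => by positivity),
    integral_const_mul, integral_gaussian, ← ENNReal.ofReal_ofNat 2]
  refine ENNReal.ofReal_le_ofReal ?_
  rw [inv_mul_le_iff₀ (by positivity), Real.sqrt_le_left (by positivity), mul_pow,
    Real.sq_sqrt (by positivity)]
  linarith [Real.pi_pos]

theorem lintegral_exp_mul_gaussianReal (t : ℝ) :
    ∫⁻ g, ENNReal.ofReal (Real.exp (t * g)) ∂(gaussianReal 0 1)
      = ENNReal.ofReal (Real.exp (t ^ 2 / 2)) := by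
  have hmgf := congrFun (mgf_fun_id_gaussianReal (μ := 0) (v := 1)) t
  rw [mgf, zero_mul, zero_add, NNReal.coe_one, one_mul] at hmgf
  rw [← ofReal_integral_eq_lintegral_ofReal (integrable_exp_mul_gaussianReal t)
    (ae_of_all _ fun g => (Real.exp_pos _).le), hmgf]

-- Averaging `exp (√(2 * s) * Y * g)` over an independent standard Gaussian `g` linearizes the
-- square in the exponent, after which the sub-Gaussian bound applies to `Y` at fixed `g`.
theorem lintegral_exp_mul_sq_le_two_of_hasSubgaussianMGF [SFinite P] {Y : Ω → ℝ}
    (hY : Measurable Y) {c : NNReal} (h : HasSubgaussianMGF Y c P) {s : ℝ} (hs : 0 ≤ s)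
    (hcs : 4 * c * s ≤ 1) : ∫⁻ ω, ENNReal.ofReal (Real.exp (s * Y ω ^ 2)) ∂P ≤ 2 := by
  have hsq : √(2 * s) ^ 2 = 2 * s := Real.sq_sqrt (by positivity)
  calc ∫⁻ ω, ENNReal.ofReal (Real.exp (s * Y ω ^ 2)) ∂P
      = ∫⁻ ω, ∫⁻ g, ENNReal.ofReal (Real.exp (√(2 * s) * Y ω * g)) ∂(gaussianReal 0 1) ∂P := by
        simp_rw [lintegral_exp_mul_gaussianReal, mul_pow, hsq]
        ring_nf
    _ = ∫⁻ g, ∫⁻ ω, ENNReal.ofReal (Real.exp (√(2 * s) * g * Y ω)) ∂P ∂(gaussianReal 0 1) := by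
        rw [lintegral_lintegral_swap (by fun_prop)]
        simp_rw [mul_right_comm]
    _ ≤ ∫⁻ g, ENNReal.ofReal (Real.exp (g ^ 2 / 4)) ∂(gaussianReal 0 1) := by
        refine lintegral_mono fun g => ?_
        rw [← ofReal_integral_eq_lintegral_ofReal (h.integrable_exp_mul _)
          (ae_of_all _ fun ω => (Real.exp_pos _).le)]
        refine ENNReal.ofReal_le_ofReal ((h.mgf_le _).trans (Real.exp_le_exp.2 ?_))
        rw [mul_pow, hsq]
        nlinarith [mul_le_mul_of_nonneg_left hcs (sq_nonneg g)]
    _ ≤ 2 := lintegral_exp_sq_div_four_gaussianReal_le_two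

theorem lintegral_exp_add_le_of_lintegral_exp_two_mul_le {f g : Ω → ℝ} (hf : Measurable f)
    (hg : Measurable g) {B : ℝ≥0∞} (hfB : ∫⁻ ω, ENNReal.ofReal (Real.exp (2 * f ω)) ∂P ≤ B)
    (hgB : ∫⁻ ω, ENNReal.ofReal (Real.exp (2 * g ω)) ∂P ≤ B) :
    ∫⁻ ω, ENNReal.ofReal (Real.exp (f ω + g ω)) ∂P ≤ B := by
  have amgm (ω : Ω) : Real.exp (f ω + g ω)
      ≤ 2⁻¹ * (Real.exp (2 * f ω) + Real.exp (2 * g ω)) := by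
    rw [two_mul, two_mul, Real.exp_add, Real.exp_add, Real.exp_add]
    linarith [two_mul_le_add_sq (Real.exp (f ω)) (Real.exp (g ω))]
  calc ∫⁻ ω, ENNReal.ofReal (Real.exp (f ω + g ω)) ∂P
      ≤ ∫⁻ ω, 2⁻¹ * (ENNReal.ofReal (Real.exp (2 * f ω)) + ENNReal.ofReal (Real.exp (2 * g ω))) ∂P
        := lintegral_mono fun ω => by
          refine (ENNReal.ofReal_le_ofReal (amgm ω)).trans_eq ?_
          rw [ENNReal.ofReal_mul (by norm_num), ENNReal.ofReal_add (Real.exp_pos _).le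
            (Real.exp_pos _).le, ENNReal.ofReal_inv_of_pos two_pos, ENNReal.ofReal_ofNat]
    _ ≤ 2⁻¹ * (B + B) := by
        rw [lintegral_const_mul _ (by fun_prop), lintegral_add_left (by fun_prop)]
        gcongr
    _ = B := by
        rw [← two_mul, ← mul_assoc, ENNReal.inv_mul_cancel two_ne_zero ENNReal.ofNat_ne_top,
          one_mul]

end SubgaussianSquare

section SubgaussianMarginals

/-- A random vector `Y` in a complex inner product space is sub-Gaussian with variance proxy `c` if
the real part of each of its one-dimensional marginals `⟪v, Y⟫` is sub-Gaussian with variance proxy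
`‖v‖ ^ 2 * c`. Imaginary parts are covered too, being the real parts of `⟪I • v, Y⟫`. -/
def HasSubgaussianMarginals {Ω E : Type*} [MeasurableSpace Ω] [NormedAddCommGroup E]
    [InnerProductSpace ℂ E] (Y : Ω → E) (c : NNReal) (P : Measure Ω) : Prop :=
  ∀ v : E, HasSubgaussianMGF (fun ω => (inner ℂ v (Y ω)).re) (‖v‖₊ ^ 2 * c) P

variable {Ω : Type*} [MeasurableSpace Ω] {P : Measure Ω}

theorem hasSubgaussianMarginals_of_bounded [IsProbabilityMeasure P] {Z : Ω → ℂ}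
    (hZ : AEMeasurable Z P) (h0 : ∫ ω, Z ω ∂P = 0) {M : NNReal} (hM : ∀ᵐ ω ∂P, ‖Z ω‖ ≤ M) :
    HasSubgaussianMarginals Z (M ^ 2) P := by
  intro v
  have hint : Integrable Z P := Integrable.of_bound hZ.aestronglyMeasurable M hM
  have hbound : ∀ᵐ ω ∂P, (inner ℂ v (Z ω)).re ∈ Set.Icc (-(‖v‖ * M)) (‖v‖ * M) := by
    filter_upwards [hM] with ω hω
    exact abs_le.1 <| (Complex.abs_re_le_norm _).trans <| (norm_inner_le_norm v _).trans <|
      mul_le_mul_of_nonneg_left hω (norm_nonneg v)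
  have hcentred : ∫ ω, (inner ℂ v (Z ω)).re ∂P = 0 := by
    change ∫ ω, RCLike.re (inner ℂ v (Z ω)) ∂P = 0
    rw [integral_re (hint.const_inner v), integral_inner hint, h0, inner_zero_right, map_zero]
  have hproxy : (‖‖v‖ * M - -(‖v‖ * M)‖₊ / 2) ^ 2 = ‖v‖₊ ^ 2 * M ^ 2 := by
    rw [sub_neg_eq_add, ← two_mul, ← mul_pow]
    ext
    simp
  rw [← hproxy]
  exact hasSubgaussianMGF_of_mem_Icc_of_integral_eq_zero
    (Complex.measurable_re.comp_aemeasurable ((innerSL ℂ v).measurable.comp_aemeasurable hZ))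
    hbound hcentred

namespace HasSubgaussianMarginals

theorem toLp_of_iIndepFun {ι : Type*} [Fintype ι] {E : ι → Type*} [∀ i, NormedAddCommGroup (E i)]
    [∀ i, InnerProductSpace ℂ (E i)] [∀ i, MeasurableSpace (E i)]
    [∀ i, OpensMeasurableSpace (E i)] {Z : ∀ i, Ω → E i} {c : NNReal} (hind : iIndepFun Z P)
    (h : ∀ i, HasSubgaussianMarginals (Z i) c P) :
    HasSubgaussianMarginals (fun ω => (WithLp.toLp 2 fun i => Z i ω : PiLp 2 E)) c P := by
  intro v
  have hind' : iIndepFun (fun i ω => (inner ℂ (v i) (Z i ω)).re) P :=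
    hind.comp (fun i z => (inner ℂ (v i) z).re) fun i =>
      Complex.measurable_re.comp (innerSL ℂ (v i)).measurable
  convert HasSubgaussianMGF.sum_of_iIndepFun hind' (s := Finset.univ) fun i _ => h i (v i) using 1
  · simp [PiLp.inner_apply]
  · ext
    simp [PiLp.norm_sq_eq_of_L2, Finset.sum_mul]

variable {E : Type*} [NormedAddCommGroup E] [InnerProductSpace ℂ E]

theorem hasSubgaussianMGF_im_inner {Y : Ω → E} {c : NNReal} (h : HasSubgaussianMarginals Y c P)
    (v : E) : HasSubgaussianMGF (fun ω => (inner ℂ v (Y ω)).im) (‖v‖₊ ^ 2 * c) P := by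
  convert h (Complex.I • v) using 2 <;> simp [nnnorm_smul]

theorem memLp_inner {Y : Ω → E} {c : NNReal} (h : HasSubgaussianMarginals Y c P) (v : E)
    (p : NNReal) : MemLp (fun ω => inner ℂ v (Y ω)) p P :=
  memLp_re_im_iff.1 ⟨(h v).memLp p, (h.hasSubgaussianMGF_im_inner v).memLp p⟩

variable [MeasurableSpace E] [OpensMeasurableSpace E]

theorem lintegral_exp_mul_norm_inner_sq_le_two [SFinite P] {Y : Ω → E} {c : NNReal}
    (h : HasSubgaussianMarginals Y c P) (hY : Measurable Y) (v : E) {s : ℝ} (hs : 0 ≤ s)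
    (hcs : 8 * (‖v‖ ^ 2 * c) * s ≤ 1) :
    ∫⁻ ω, ENNReal.ofReal (Real.exp (s * ‖inner ℂ v (Y ω)‖ ^ 2)) ∂P ≤ 2 := by
  have hinner : Measurable fun ω => inner ℂ v (Y ω) := (innerSL ℂ v).measurable.comp hY
  have hcs' : 4 * (‖v‖₊ ^ 2 * c : NNReal) * (2 * s) ≤ 1 := by
    push_cast
    linarith
  have hre := lintegral_exp_mul_sq_le_two_of_hasSubgaussianMGF
    (Complex.measurable_re.comp hinner) (h v) (by positivity) hcs'
  have him := lintegral_exp_mul_sq_le_two_of_hasSubgaussianMGF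
    (Complex.measurable_im.comp hinner) (h.hasSubgaussianMGF_im_inner v) (by positivity) hcs'
  simp_rw [Function.comp_apply, mul_assoc] at hre him
  simp_rw [← Complex.normSq_eq_norm_sq, Complex.normSq_apply, ← sq, mul_add]
  exact lintegral_exp_add_le_of_lintegral_exp_two_mul_le (by fun_prop) (by fun_prop) hre him

theorem measureReal_le_abs_sum_norm_inner_sq_sub_integral_le {ι : Type*} [Fintype ι]
    {Y : ι → Ω → E} {c : NNReal} (h : ∀ i, HasSubgaussianMarginals (Y i) c P)
    (hY : ∀ i, Measurable (Y i)) (hind : iIndepFun Y P) (v : E) {s : ℝ} (hs : 0 ≤ s)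
    (hcs : 8 * (‖v‖ ^ 2 * c) * s ≤ 1) (ε : ℝ) {r : ℝ} (hr0 : 0 ≤ r) (hr : r ≤ 1 / 2) :
    P.real {ω | ε ≤ s * |∑ i, (‖inner ℂ v (Y i ω)‖ ^ 2 - ∫ ω', ‖inner ℂ v (Y i ω')‖ ^ 2 ∂P)|}
      ≤ 2 * Real.exp (-r * ε + 48 * r ^ 2 * Fintype.card ι) := by
  have := hind.isProbabilityMeasure
  have hv : Measurable fun y : E => inner ℂ v y := (innerSL ℂ v).measurable
  let W (i : ι) (ω : Ω) : ℝ :=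
    s * ‖inner ℂ v (Y i ω)‖ ^ 2 - ∫ ω', s * ‖inner ℂ v (Y i ω')‖ ^ 2 ∂P
  have hW (i : ι) : HasSubexponentialMGF (W i) 96 (1 / 2) P :=
    hasSubexponentialMGF_sub_integral (((hv.comp (hY i)).norm.pow_const 2).const_mul s)
      (fun ω => by positivity) ((h i).lintegral_exp_mul_norm_inner_sq_le_two (hY i) v hs hcs)
  have hWm (i : ι) : Measurable (W i) :=
    (((hv.comp (hY i)).norm.pow_const 2).const_mul s).sub_const _
  have hWind : iIndepFun W P :=
    hind.comp (fun i y => s * ‖inner ℂ v y‖ ^ 2 - ∫ ω', s * ‖inner ℂ v (Y i ω')‖ ^ 2 ∂P) fun i =>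
      ((hv.norm.pow_const 2).const_mul s).sub_const _
  have hsum (ω : Ω) : |(∑ i, W i) ω|
      = s * |∑ i, (‖inner ℂ v (Y i ω)‖ ^ 2 - ∫ ω', ‖inner ℂ v (Y i ω')‖ ^ 2 ∂P)| := by
    simp only [W, Finset.sum_apply, integral_const_mul, ← mul_sub, ← Finset.mul_sum, abs_mul,
      abs_of_nonneg hs]
  simp_rw [← hsum]
  refine ((HasSubexponentialMGF.sum_of_iIndepFun hWm hWind hW).measureReal_le_abs_le ε hr0
    hr).trans_eq ?_
  rw [Finset.sum_const, Finset.card_univ, nsmul_eq_mul]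
  ring_nf

end HasSubgaussianMarginals

end SubgaussianMarginals

section Net

variable {E : Type*} [NormedAddCommGroup E] [NormedSpace ℝ E] [FiniteDimensional ℝ E]

theorem card_le_of_isSeparated_half {N : Finset E} (hN : ∀ v ∈ N, ‖v‖ ≤ 1)
    (hsep : Metric.IsSeparated (2⁻¹ : NNReal) (N : Set E)) :
    N.card ≤ 5 ^ Module.finrank ℝ E := by
  classical
  have hinj : Function.Injective fun v : E => (2 : ℝ) • v := smul_right_injective E two_ne_zero
  rw [← Finset.card_image_of_injective N hinj]
  refine Besicovitch.card_le_of_separated _ ?_ ?_ <;>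
    simp only [Finset.forall_mem_image, ← smul_sub, norm_smul, Real.norm_ofNat]
  · intro v hv
    linarith [hN v hv]
  · intro v hv w hw hne
    have hlt : (2⁻¹ : ℝ) < dist v w := by
      have : (2⁻¹ : NNReal) < edist v w := hsep hv hw (ne_of_apply_ne _ hne)
      rw [edist_nndist, ENNReal.coe_lt_coe] at this
      exact_mod_cast this
    rw [dist_eq_norm] at hlt
    linarith

theorem packingNumber_half_le_of_subset_closedBall {A : Set E} (hA : A ⊆ Metric.closedBall 0 1) :
    Metric.packingNumber 2⁻¹ A ≤ (5 ^ Module.finrank ℝ E : ℕ) := by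
  refine iSup₂_le fun C hCA => iSup_le fun hC => ?_
  by_contra! hcard
  obtain ⟨N, hNC, hN⟩ := Set.exists_subset_encard_eq (Order.add_one_le_of_lt hcard)
  have hfin : N.Finite := Set.finite_of_encard_eq_coe hN
  lift N to Finset E using hfin
  have := card_le_of_isSeparated_half
    (fun v hv => mem_closedBall_zero_iff.1 (hA (hCA (hNC hv)))) (hC.subset hNC)
  rw [Set.encard_coe_eq_coe_finsetCard] at hN
  norm_cast at hN
  omega

theorem exists_finset_isCover_half_sphere :
    ∃ N : Finset E, N.card ≤ 5 ^ Module.finrank ℝ E ∧ (∀ v ∈ N, ‖v‖ = 1) ∧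
      ∀ u : E, ‖u‖ = 1 → ∃ v ∈ N, ‖u - v‖ ≤ 1 / 2 := by
  have hpack := packingNumber_half_le_of_subset_closedBall (E := E) Metric.sphere_subset_closedBall
  have hne := ne_top_of_le_ne_top (ENat.natCast_ne_top _) hpack
  have hcard := (Metric.encard_maximalSeparatedSet hne).trans_le hpack
  have hsub : Metric.maximalSeparatedSet 2⁻¹ (Metric.sphere (0 : E) 1) ⊆ Metric.sphere 0 1 :=
    Metric.maximalSeparatedSet_subset
  have hcover := Metric.isCover_iff_subset_iUnion_closedBall.1
    (Metric.isCover_maximalSeparatedSet hne)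
  generalize Metric.maximalSeparatedSet 2⁻¹ (Metric.sphere (0 : E) 1) = N at hcard hsub hcover
  lift N to Finset E using Set.finite_of_encard_le_coe hcard
  refine ⟨N, ?_, fun v hv => mem_sphere_zero_iff_norm.1 (hsub hv), fun u hu => ?_⟩
  · rw [Set.encard_coe_eq_coe_finsetCard] at hcard
    exact_mod_cast hcard
  · simpa [dist_eq_norm] using hcover (mem_sphere_zero_iff_norm.2 hu)

end Net

section QuadraticForm

variable {E : Type*} [NormedAddCommGroup E] [InnerProductSpace ℂ E]

theorem exists_norm_eq_one_apply_eq_smul_of_isSelfAdjoint [FiniteDimensional ℂ E] [Nontrivial E]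
    {T : E →L[ℂ] E} (hT : IsSelfAdjoint T) :
    ∃ u : E, ‖u‖ = 1 ∧ ∃ c : ℝ, |c| = ‖T‖ ∧ T u = (c : ℂ) • u := by
  have eigenvector {c : ℝ} (hc : c ∈ spectrum ℝ T) : ∃ u : E, ‖u‖ = 1 ∧ T u = (c : ℂ) • u := by
    have hc' : (c : ℂ) ∈ spectrum ℂ (T : E →ₗ[ℂ] E) := by
      have := spectrum.algebraMap_mem ℂ hc
      rwa [← AlgEquiv.spectrum_eq (Module.End.toContinuousLinearMap E).symm] at this
    obtain ⟨w, hw⟩ := (Module.End.hasEigenvalue_iff_mem_spectrum.2 hc').exists_hasEigenvector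
    refine ⟨((‖w‖⁻¹ : ℝ) : ℂ) • w, ?_, ?_⟩
    · simp [norm_smul, hw.2]
    · have hTw : T w = (c : ℂ) • w := hw.apply_eq_smul
      rw [map_smul, hTw, smul_comm]
  rcases CStarAlgebra.norm_or_neg_norm_mem_spectrum (a := T) hT with h | h
  all_goals
    obtain ⟨u, hu, hTu⟩ := eigenvector h
    exact ⟨u, hu, _, by simp, hTu⟩

-- With `w = v - u`, the value of the quadratic form at `v` is `c * (1 - ‖w‖ ^ 2) + ⟪T w, w⟫`: the
-- cross terms are absorbed by `‖u + w‖ = 1`, so the error is quadratic in `‖w‖`.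
theorem norm_le_two_mul_abs_reApplyInnerSelf {T : E →L[ℂ] E} (hT : T.IsSymmetric) {u v : E}
    (hu : ‖u‖ = 1) (hv : ‖v‖ = 1) {c : ℝ} (hc : |c| = ‖T‖) (hTu : T u = (c : ℂ) • u)
    (huv : ‖u - v‖ ≤ 1 / 2) : ‖T‖ ≤ 2 * |T.reApplyInnerSelf v| := by
  obtain ⟨w, rfl⟩ : ∃ w, v = u + w := ⟨v - u, by abel⟩
  rw [sub_add_cancel_left, norm_neg] at huv
  have hre : 2 * (inner ℂ u w).re = -‖w‖ ^ 2 := by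
    have := norm_add_sq (𝕜 := ℂ) u w
    rw [hu, hv, RCLike.re_eq_complex_re] at this
    linarith
  have hform : T.reApplyInnerSelf (u + w) = c * (1 - ‖w‖ ^ 2) + T.reApplyInnerSelf w := by
    have hcross : inner ℂ (T w) u = c * inner ℂ w u := by
      rw [show inner ℂ (T w) u = inner ℂ w (T u) from hT w u, hTu, inner_smul_right]
    simp only [ContinuousLinearMap.reApplyInnerSelf_apply, map_add, inner_add_left,
      inner_add_right, hTu, hcross, inner_smul_left, Complex.conj_ofReal, RCLike.re_eq_complex_re,
      Complex.re_ofReal_mul, inner_self_eq_norm_sq_to_K, hu]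
    rw [← inner_conj_symm w u, Complex.conj_re]
    simp
    linear_combination c * hre
  have herror : |T.reApplyInnerSelf w| ≤ ‖T‖ * ‖w‖ ^ 2 := by
    refine (Complex.abs_re_le_norm _).trans ((norm_inner_le_norm _ _).trans ?_)
    rw [sq, ← mul_assoc]
    exact mul_le_mul_of_nonneg_right (T.le_opNorm w) (norm_nonneg w)
  have hw : ‖w‖ ^ 2 ≤ (1 / 2) ^ 2 := pow_le_pow_left₀ (norm_nonneg w) huv 2
  have hmain : |c * (1 - ‖w‖ ^ 2)| = ‖T‖ * (1 - ‖w‖ ^ 2) := by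
    rw [abs_mul, hc, abs_of_nonneg (by linarith)]
  have := abs_sub_abs_le_abs_add (c * (1 - ‖w‖ ^ 2)) (T.reApplyInnerSelf w)
  rw [hform]
  nlinarith [mul_le_mul_of_nonneg_left hw (norm_nonneg T)]

theorem exists_mem_norm_le_two_mul_abs_reApplyInnerSelf [FiniteDimensional ℂ E] [Nontrivial E]
    {T : E →L[ℂ] E} (hT : IsSelfAdjoint T) {N : Set E} (hN1 : ∀ v ∈ N, ‖v‖ = 1)
    (hN : ∀ u : E, ‖u‖ = 1 → ∃ v ∈ N, ‖u - v‖ ≤ 1 / 2) :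
    ∃ v ∈ N, ‖T‖ ≤ 2 * |T.reApplyInnerSelf v| := by
  obtain ⟨u, hu, c, hc, hTu⟩ := exists_norm_eq_one_apply_eq_smul_of_isSelfAdjoint hT
  obtain ⟨v, hv, huv⟩ := hN u hu
  exact ⟨v, hv, norm_le_two_mul_abs_reApplyInnerSelf hT.isSymmetric hu (hN1 v hv) hc hTu huv⟩

variable {m n : Type*} [Fintype m] [Fintype n] [DecidableEq m]

theorem frobenius_norm_le_sqrt_card_mul_norm_toEuclideanCLM (A : Matrix m m ℂ) :
    ‖A‖ ≤ √(Fintype.card m) * ‖Matrix.toEuclideanCLM (n := m) (𝕜 := ℂ) A‖ := by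
  set T := Matrix.toEuclideanCLM (n := m) (𝕜 := ℂ) A
  have hcol (j : m) : ∑ i, ‖A i j‖ ^ 2 ≤ ‖T‖ ^ 2 := calc
    ∑ i, ‖A i j‖ ^ 2 = ‖T (EuclideanSpace.single j 1)‖ ^ 2 := by
      simp [T, EuclideanSpace.norm_sq_eq, Matrix.ofLp_toEuclideanCLM]
    _ ≤ ‖T‖ ^ 2 := by
      gcongr
      simpa using T.le_opNorm (EuclideanSpace.single j 1)
  refine (sq_le_sq₀ (norm_nonneg A) (by positivity)).1 ?_
  rw [mul_pow, Real.sq_sqrt (by positivity), Matrix.frobenius_norm_def, ← Real.sqrt_eq_rpow,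
    Real.sq_sqrt (by positivity), Finset.sum_comm, ← nsmul_eq_mul]
  simp only [Real.rpow_two]
  exact Finset.sum_le_card_nsmul _ _ _ fun j _ => hcol j

theorem reApplyInnerSelf_toEuclideanCLM (A : Matrix m m ℂ) (v : EuclideanSpace ℂ m) :
    (Matrix.toEuclideanCLM (n := m) (𝕜 := ℂ) A).reApplyInnerSelf v = (star ⇑v ⬝ᵥ A *ᵥ ⇑v).re := by
  rw [ContinuousLinearMap.reApplyInnerSelf_apply, inner_re_symm,
    EuclideanSpace.inner_eq_star_dotProduct, dotProduct_comm, Matrix.ofLp_toEuclideanCLM,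
    RCLike.re_eq_complex_re]

theorem reApplyInnerSelf_toEuclideanCLM_mul_conjTranspose (A : Matrix m n ℂ)
    (v : EuclideanSpace ℂ m) :
    (Matrix.toEuclideanCLM (n := m) (𝕜 := ℂ) (A * Aᴴ)).reApplyInnerSelf v
      = ∑ t, ‖inner ℂ v (WithLp.toLp 2 (A.col t))‖ ^ 2 := by
  rw [reApplyInnerSelf_toEuclideanCLM, ← Matrix.mulVec_mulVec, Matrix.dotProduct_mulVec,
    ← star_star (Aᴴ *ᵥ ⇑v), Matrix.star_mulVec, Matrix.conjTranspose_conjTranspose, dotProduct,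
    Complex.re_sum]
  refine Finset.sum_congr rfl fun t _ => ?_
  rw [Pi.star_apply, RCLike.star_def, Complex.mul_conj, Complex.ofReal_re,
    Complex.normSq_eq_norm_sq, EuclideanSpace.inner_eq_star_dotProduct, dotProduct_comm]
  rfl

end QuadraticForm

section RandomMatrix

variable {Ω : Type*} [MeasurableSpace Ω] {P : Measure Ω}

theorem iIndepFun_curry {ι κ E : Type*} [MeasurableSpace E] {X : ι → κ → Ω → E}
    (hX : ∀ i j, Measurable (X i j)) (h : iIndepFun (fun p : ι × κ => X p.1 p.2) P) :
    iIndepFun (fun i ω j => X i j ω) P := by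
  have := h.isProbabilityMeasure
  have hmap (i : ι) (j : κ) : IsProbabilityMeasure (P.map (X i j)) :=
    Measure.isProbabilityMeasure_map (hX i j).aemeasurable
  have hrow (i : ι) : iIndepFun (X i) P :=
    h.precomp (g := fun j => (i, j)) (Prod.mk_right_injective i)
  rw [iIndepFun_iff_map_fun_eq_infinitePi_map (by fun_prop)] at h ⊢
  calc P.map (fun ω i j => X i j ω)
      = (P.map fun ω (p : ι × κ) => X p.1 p.2 ω).map (MeasurableEquiv.curry ι κ E) := by
        rw [Measure.map_map (by fun_prop) (by fun_prop)]
        rfl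
    _ = Measure.infinitePi fun i => Measure.infinitePi fun j => P.map (X i j) := by
        rw [h, Measure.infinitePi_map_curry fun i j => P.map (X i j)]
    _ = Measure.infinitePi fun i => P.map fun ω j => X i j ω := by
        congr! 2 with i
        exact ((iIndepFun_iff_map_fun_eq_infinitePi_map (by fun_prop)).1 (hrow i)).symm

variable {m n : Type*}

/-- The `t`-th column of a random complex matrix, as a random vector of the Euclidean space (so
that sub-Gaussianity of columns refers to the `ℓ²` norm and inner product). -/
def randomColumn (X : Ω → Matrix m n ℂ) (t : n) (ω : Ω) : EuclideanSpace ℂ m :=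
  WithLp.toLp 2 ((X ω).col t)

theorem measurable_randomColumn {X : Ω → Matrix m n ℂ} (hX : ∀ k t, Measurable fun ω => X ω k t)
    (t : n) : Measurable (randomColumn X t) :=
  (WithLp.measurable_toLp 2 _).comp (measurable_pi_iff.2 fun k => hX k t)

theorem iIndepFun_randomColumn {X : Ω → Matrix m n ℂ} (hX : ∀ k t, Measurable fun ω => X ω k t)
    (hind : iIndepFun (fun (p : m × n) ω => X ω p.1 p.2) P) : iIndepFun (randomColumn X) P :=
  (iIndepFun_curry (X := fun t k ω => X ω k t) (fun t k => hX k t)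
    (hind.precomp Prod.swap_injective)).comp (fun _ => WithLp.toLp 2)
      fun _ => WithLp.measurable_toLp 2 _

theorem hasSubgaussianMarginals_randomColumn [Fintype m] {X : Ω → Matrix m n ℂ}
    (hX : ∀ k t, Measurable fun ω => X ω k t)
    (hind : iIndepFun (fun (p : m × n) ω => X ω p.1 p.2) P) (h0 : ∀ k t, ∫ ω, X ω k t ∂P = 0)
    {M : NNReal} (hM : ∀ k t, ∀ᵐ ω ∂P, ‖X ω k t‖ ≤ M) (t : n) :
    HasSubgaussianMarginals (randomColumn X t) (M ^ 2) P :=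
  have := hind.isProbabilityMeasure
  HasSubgaussianMarginals.toLp_of_iIndepFun (Z := fun k ω => X ω k t)
    (hind.precomp (Prod.mk_left_injective t)) fun k =>
      hasSubgaussianMarginals_of_bounded (hX k t).aemeasurable (h0 k t) (hM k t)

theorem memLp_apply_of_hasSubgaussianMarginals_randomColumn [Fintype m]
    {X : Ω → Matrix m n ℂ} {c : NNReal} (t : n)
    (h : HasSubgaussianMarginals (randomColumn X t) c P) (k : m) (p : NNReal) :
    MemLp (fun ω => X ω k t) p P := by
  classical
  simpa [randomColumn, EuclideanSpace.inner_single_left] using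
    h.memLp_inner (EuclideanSpace.single k 1) p

theorem integrable_mul_conjTranspose_apply [Fintype n] {X : Ω → Matrix m n ℂ}
    (hX : ∀ k t, MemLp (fun ω => X ω k t) 2 P) (k l : m) :
    Integrable (fun ω => (X ω * (X ω)ᴴ) k l) P := by
  simp only [Matrix.mul_apply, Matrix.conjTranspose_apply]
  exact integrable_finsetSum _ fun t _ => (hX k t).integrable_mul (hX l t).star

theorem isHermitian_matrixExpectation {M : Ω → Matrix m m ℂ} (hM : ∀ ω, (M ω).IsHermitian) :
    (matrixExpectation P M).IsHermitian := by
  ext i j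
  simp only [matrixExpectation, Matrix.conjTranspose_apply, Matrix.of_apply]
  rw [RCLike.star_def, ← integral_conj]
  exact integral_congr_ae (ae_of_all _ fun ω => (hM ω).apply i j)

variable [Fintype m] [DecidableEq m]

theorem reApplyInnerSelf_toEuclideanCLM_matrixExpectation {M : Ω → Matrix m m ℂ}
    (hM : ∀ i j, Integrable (fun ω => M ω i j) P) (v : EuclideanSpace ℂ m) :
    (Matrix.toEuclideanCLM (n := m) (𝕜 := ℂ) (matrixExpectation P M)).reApplyInnerSelf v
      = ∫ ω, (Matrix.toEuclideanCLM (n := m) (𝕜 := ℂ) (M ω)).reApplyInnerSelf v ∂P := by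
  have hrow (i : m) : Integrable (fun ω => star (v i) * ∑ j, M ω i j * v j) P :=
    (integrable_finsetSum _ fun j _ => (hM i j).mul_const _).const_mul _
  simp only [reApplyInnerSelf_toEuclideanCLM, dotProduct, Matrix.mulVec, Pi.star_apply]
  rw [← RCLike.re_eq_complex_re, integral_re (integrable_finsetSum _ fun i _ => hrow i),
    integral_finsetSum _ fun i _ => hrow i]
  congr! with i
  rw [integral_const_mul, integral_finsetSum _ fun j _ => (hM i j).mul_const _]
  simp only [integral_mul_const, matrixExpectation, Matrix.of_apply]

theorem reApplyInnerSelf_toEuclideanCLM_sub_matrixExpectation [Fintype n]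
    {X : Ω → Matrix m n ℂ} {c : NNReal} (h : ∀ t, HasSubgaussianMarginals (randomColumn X t) c P)
    (v : EuclideanSpace ℂ m) (ω : Ω) :
    (Matrix.toEuclideanCLM (n := m) (𝕜 := ℂ)
        (X ω * (X ω)ᴴ - matrixExpectation P fun ω => X ω * (X ω)ᴴ)).reApplyInnerSelf v
      = ∑ t, (‖inner ℂ v (randomColumn X t ω)‖ ^ 2
          - ∫ ω', ‖inner ℂ v (randomColumn X t ω')‖ ^ 2 ∂P) := by
  have hint (t : n) : Integrable (fun ω => ‖inner ℂ v (randomColumn X t ω)‖ ^ 2) P :=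
    ((h t).memLp_inner v 2).integrable_norm_pow two_ne_zero
  have hent (k : m) (t : n) : MemLp (fun ω => X ω k t) 2 P :=
    memLp_apply_of_hasSubgaussianMarginals_randomColumn t (h t) k 2
  have hsub (A B : Matrix m m ℂ) :
      (Matrix.toEuclideanCLM (n := m) (𝕜 := ℂ) (A - B)).reApplyInnerSelf v
        = (Matrix.toEuclideanCLM (n := m) (𝕜 := ℂ) A).reApplyInnerSelf v
          - (Matrix.toEuclideanCLM (n := m) (𝕜 := ℂ) B).reApplyInnerSelf v := by
    simp only [reApplyInnerSelf_toEuclideanCLM, Matrix.sub_mulVec, dotProduct_sub, Complex.sub_re]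
  rw [hsub, reApplyInnerSelf_toEuclideanCLM_matrixExpectation
    (integrable_mul_conjTranspose_apply hent)]
  simp only [reApplyInnerSelf_toEuclideanCLM_mul_conjTranspose]
  rw [Finset.sum_sub_distrib, ← integral_finsetSum _ fun t _ => hint t]
  rfl

end RandomMatrix

section Concentration

theorem exists_finset_card_le_twentyFive_pow_isCover_half_sphere (m : Type*) [Fintype m] :
    ∃ N : Finset (EuclideanSpace ℂ m), N.card ≤ 25 ^ Fintype.card m ∧ (∀ v ∈ N, ‖v‖ = 1) ∧
      ∀ u : EuclideanSpace ℂ m, ‖u‖ = 1 → ∃ v ∈ N, ‖u - v‖ ≤ 1 / 2 := by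
  have hdim : Module.finrank ℝ (EuclideanSpace ℂ m) = 2 * Fintype.card m := by
    rw [← Module.finrank_mul_finrank ℝ ℂ, Complex.finrank_real_complex, finrank_euclideanSpace]
  have : FiniteDimensional ℝ (EuclideanSpace ℂ m) := FiniteDimensional.complexToReal _
  simpa only [hdim, pow_mul, Nat.reducePow] using
    exists_finset_isCover_half_sphere (E := EuclideanSpace ℂ m)

variable {Ω m n : Type*} [MeasurableSpace Ω] {P : Measure Ω} [Fintype m]

theorem measureReal_le_norm_div_sqrt_card_le [Nonempty m] [DecidableEq m] [IsFiniteMeasure P]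
    {A : Ω → Matrix m m ℂ} (hA : ∀ ω, (A ω).IsHermitian) {a p : ℝ}
    (hp : ∀ v : EuclideanSpace ℂ m, ‖v‖ = 1 → P.real {ω | a ≤
      2 * |(Matrix.toEuclideanCLM (n := m) (𝕜 := ℂ) (A ω)).reApplyInnerSelf v|} ≤ p) :
    P.real {ω | a ≤ ‖A ω‖ / √(Fintype.card m)} ≤ 25 ^ Fintype.card m * p := by
  obtain ⟨N, hNcard, hN1, hN⟩ := exists_finset_card_le_twentyFive_pow_isCover_half_sphere m
  have hp0 : 0 ≤ p :=
    measureReal_nonneg.trans (hp (EuclideanSpace.single (Classical.arbitrary m) 1) (by simp))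
  have hsub : {ω | a ≤ ‖A ω‖ / √(Fintype.card m)} ⊆ ⋃ v ∈ N, {ω | a ≤
      2 * |(Matrix.toEuclideanCLM (n := m) (𝕜 := ℂ) (A ω)).reApplyInnerSelf v|} := by
    intro ω hω
    have hself : IsSelfAdjoint (Matrix.toEuclideanCLM (n := m) (𝕜 := ℂ) (A ω)) :=
      (hA ω).isSelfAdjoint.map _
    obtain ⟨v, hv, hle⟩ := exists_mem_norm_le_two_mul_abs_reApplyInnerSelf hself hN1 hN
    have hfrob : ‖A ω‖ / √(Fintype.card m) ≤ ‖Matrix.toEuclideanCLM (n := m) (𝕜 := ℂ) (A ω)‖ :=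
      div_le_of_le_mul₀ (by positivity) (by positivity) <|
        (frobenius_norm_le_sqrt_card_mul_norm_toEuclideanCLM (A ω)).trans_eq (mul_comm _ _)
    exact Set.mem_biUnion hv (le_trans hω (hfrob.trans hle))
  calc P.real {ω | a ≤ ‖A ω‖ / √(Fintype.card m)}
      ≤ ∑ v ∈ N, P.real {ω | a ≤
          2 * |(Matrix.toEuclideanCLM (n := m) (𝕜 := ℂ) (A ω)).reApplyInnerSelf v|} :=
        (measureReal_mono hsub (measure_ne_top _ _)).trans (measureReal_biUnion_finset_le _ _)
    _ ≤ N.card * p := by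
        rw [← nsmul_eq_mul]
        exact Finset.sum_le_card_nsmul _ _ _ fun v hv => hp v (hN1 v hv)
    _ ≤ 25 ^ Fintype.card m * p := by
        gcongr
        exact_mod_cast hNcard

-- The optimal choice `r = δ / 1536` for `δ ≤ 1` is too large for big `δ`, so the witness is
-- `r = min 1 δ / 1536`; the exponent stays quadratic because `min 1 δ * max δ (δ ^ 2) = δ ^ 2`.
theorem exists_rate_le {δ : ℝ} (hδ : 0 < δ) :
    ∃ r, 0 ≤ r ∧ r ≤ 1 / 2 ∧ -r * (max δ (δ ^ 2) / 16) + 48 * r ^ 2 ≤ -(δ ^ 2 / 49152) := by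
  have hmin : 0 < min 1 δ := lt_min one_pos hδ
  have hprod : min 1 δ * max δ (δ ^ 2) = δ ^ 2 := by
    rcases le_total δ 1 with h | h
    · rw [min_eq_right h, max_eq_left (pow_le_of_le_one hδ.le h two_ne_zero), sq]
    · rw [min_eq_left h, max_eq_right (le_self_pow₀ h two_ne_zero), one_mul]
  have hsq : min 1 δ ^ 2 ≤ δ ^ 2 := pow_le_pow_left₀ hmin.le (min_le_right 1 δ) 2
  exact ⟨min 1 δ / 1536, by positivity, by linarith [min_le_left 1 δ], by linarith⟩

theorem measureReal_le_two_mul_abs_reApplyInnerSelf_le [DecidableEq m] [Fintype n] [Nonempty n]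
    {X : Ω → Matrix m n ℂ} (hX : ∀ k t, Measurable fun ω => X ω k t)
    (hind : iIndepFun (randomColumn X) P) {S : NNReal} (hS : S ≠ 0)
    (h : ∀ t, HasSubgaussianMarginals (randomColumn X t) (S ^ 2 / Fintype.card n) P)
    {δ : ℝ} (hδ : 0 < δ) {v : EuclideanSpace ℂ m} (hv : ‖v‖ = 1) :
    P.real {ω | S ^ 2 * max δ (δ ^ 2) ≤ 2 * |(Matrix.toEuclideanCLM (n := m) (𝕜 := ℂ)
        (X ω * (X ω)ᴴ - matrixExpectation P fun ω => X ω * (X ω)ᴴ)).reApplyInnerSelf v|}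
      ≤ 2 * Real.exp (-(δ ^ 2 * Fintype.card n / 49152)) := by
  obtain ⟨r, hr0, hr, hrate⟩ := exists_rate_le hδ
  have hn : (0 : ℝ) < Fintype.card n := by exact_mod_cast Fintype.card_pos
  have hS' : (0 : ℝ) < S := by exact_mod_cast hS.bot_lt
  have hscale (q : ℝ) : S ^ 2 * max δ (δ ^ 2) ≤ 2 * q ↔
      Fintype.card n * (max δ (δ ^ 2) / 16) ≤ Fintype.card n / (8 * S ^ 2) * q := by
    rw [← mul_le_mul_iff_right₀ (show (0 : ℝ) < Fintype.card n / (16 * S ^ 2) by positivity)]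
    field_simp
    rw [← mul_le_mul_iff_right₀ (show (0 : ℝ) < 8 by norm_num)]
    ring_nf
  simp only [reApplyInnerSelf_toEuclideanCLM_sub_matrixExpectation h, hscale]
  refine (HasSubgaussianMarginals.measureReal_le_abs_sum_norm_inner_sq_sub_integral_le h
    (measurable_randomColumn hX) hind v (by positivity) ?_ _ hr0 hr).trans ?_
  · rw [hv]
    push_cast
    field_simp
    norm_num
  · gcongr
    linear_combination (Fintype.card n : ℝ) * hrate

theorem twentyFive_pow_mul_exp_lt {K : ℕ} (hK : 1 ≤ K) {x : ℝ} (hx : √(K : ℝ) ≤ x) :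
    25 ^ K * (2 * Real.exp (-(5 * x ^ 2))) < 2 * Real.exp (-((x - √(K : ℝ)) ^ 2)) := by
  have hK' : (1 : ℝ) ≤ K := by exact_mod_cast hK
  have hsqrt : √(K : ℝ) ^ 2 = K := Real.sq_sqrt (by positivity)
  have h25 : (25 : ℝ) ≤ Real.exp 4 := calc
    (25 : ℝ) ≤ 2.7 ^ 4 := by norm_num
    _ ≤ Real.exp 1 ^ 4 := by
      gcongr
      linarith [Real.exp_one_gt_d9]
    _ = Real.exp 4 := by
      rw [← Real.exp_nat_mul]
      norm_num
  calc (25 : ℝ) ^ K * (2 * Real.exp (-(5 * x ^ 2)))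
      ≤ Real.exp 4 ^ K * (2 * Real.exp (-(5 * x ^ 2))) := by gcongr
    _ = 2 * Real.exp (K * 4 - 5 * x ^ 2) := by
      rw [← Real.exp_nat_mul, sub_eq_add_neg, Real.exp_add]
      ring
    _ < 2 * Real.exp (-((x - √(K : ℝ)) ^ 2)) := by
      gcongr
      nlinarith [Real.sqrt_nonneg (K : ℝ)]

theorem proposition1_general [Nonempty m] [Fintype n] {X : Ω → Matrix m n ℂ}
    (hX : ∀ k t, Measurable fun ω => X ω k t) (hind : iIndepFun (randomColumn X) P) {S : NNReal}
    (hS : S ≠ 0) (h : ∀ t, HasSubgaussianMarginals (randomColumn X t) (S ^ 2 / Fintype.card n) P)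
    {δ : ℝ} (hδ : 0 < δ) (hn : 512 ^ 2 * Fintype.card m / δ ^ 2 ≤ (Fintype.card n : ℝ)) :
    P.real {ω | 1 / Real.log 2 * S ^ 2 * max δ (δ ^ 2) ≤
        ‖X ω * (X ω)ᴴ - matrixExpectation P fun ω => X ω * (X ω)ᴴ‖ / √(Fintype.card m)}
      < 2 * Real.exp (-((δ * √(Fintype.card n) / 512 - √(Fintype.card m)) ^ 2)) := by
  classical
  have := hind.isProbabilityMeasure
  have hn0 : (0 : ℝ) < Fintype.card n := lt_of_lt_of_le (by positivity) hn
  have : Nonempty n := Fintype.card_pos_iff.1 (by exact_mod_cast hn0)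
  have hHerm (ω : Ω) :
      (X ω * (X ω)ᴴ - matrixExpectation P fun ω => X ω * (X ω)ᴴ).IsHermitian :=
    (Matrix.isHermitian_mul_conjTranspose_self _).sub
      (isHermitian_matrixExpectation fun ω => Matrix.isHermitian_mul_conjTranspose_self _)
  have hlog : 1 ≤ 1 / Real.log 2 :=
    (one_le_div (Real.log_pos one_lt_two)).2 (by linarith [Real.log_two_lt_d9])
  have hx2 : (δ * √(Fintype.card n) / 512) ^ 2 = δ ^ 2 * Fintype.card n / 512 ^ 2 := by
    rw [div_pow, mul_pow, Real.sq_sqrt hn0.le]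
  have hx : √(Fintype.card m) ≤ δ * √(Fintype.card n) / 512 := by
    refine Real.sqrt_le_iff.2 ⟨by positivity, ?_⟩
    rw [hx2, le_div_iff₀ (by norm_num)]
    linarith [(div_le_iff₀ (by positivity)).1 hn]
  calc _ ≤ P.real {ω | S ^ 2 * max δ (δ ^ 2) ≤
        ‖X ω * (X ω)ᴴ - matrixExpectation P fun ω => X ω * (X ω)ᴴ‖ / √(Fintype.card m)} := by
        refine measureReal_mono (Set.ofPred_subset_ofPred.2 fun ω => le_trans ?_)
        rw [mul_assoc]
        exact le_mul_of_one_le_left (by positivity) hlog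
    _ ≤ 25 ^ Fintype.card m * (2 * Real.exp (-(δ ^ 2 * Fintype.card n / 49152))) :=
        measureReal_le_norm_div_sqrt_card_le hHerm fun v hv =>
          measureReal_le_two_mul_abs_reApplyInnerSelf_le hX hind hS h hδ hv
    _ ≤ 25 ^ Fintype.card m * (2 * Real.exp (-(5 * (δ * √(Fintype.card n) / 512) ^ 2))) := by
        rw [hx2]
        gcongr
        linarith [mul_pos (pow_pos hδ 2) hn0]
    _ < _ := twentyFive_pow_mul_exp_lt Fintype.card_pos hx

end Concentration

section EntrySupNorm

variable {Ω m n : Type*} [MeasurableSpace Ω] {P : Measure Ω} {X : Ω → Matrix m n ℂ}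

theorem ae_norm_le_of_entrySupNorm_le {M : NNReal} (h : entrySupNorm P X ≤ M) (k : m) (t : n) :
    ∀ᵐ ω ∂P, ‖X ω k t‖ ≤ M := by
  have hess : eLpNorm (fun ω => X ω k t) ∞ P ≤ M :=
    (le_iSup₂ (f := fun i j => eLpNorm (fun ω => X ω i j) ∞ P) k t).trans h
  rw [eLpNorm_exponent_top] at hess
  filter_upwards [ae_le_eLpNormEssSup (f := fun ω => X ω k t) (μ := P)] with ω hω
  exact_mod_cast enorm_le_coe.1 (hω.trans hess)

theorem entrySupNorm_ne_zero_of_matrixExpectation_eq_one [Nonempty m] [DecidableEq m] [Fintype n]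
    (hE : matrixExpectation P (fun ω => X ω * (X ω)ᴴ) = 1) : entrySupNorm P X ≠ 0 := by
  intro h0
  let k : m := Classical.arbitrary m
  have hzero : ∀ᵐ ω ∂P, (X ω * (X ω)ᴴ) k k = 0 := by
    filter_upwards [ae_all_iff.2 fun t => ae_norm_le_of_entrySupNorm_le (M := 0) h0.le k t]
      with ω hω
    simp [Matrix.mul_apply, norm_le_zero_iff.1 (hω _)]
  have hone : ∫ ω, (X ω * (X ω)ᴴ) k k ∂P = 1 := by
    simpa [matrixExpectation] using congr_fun₂ hE k k
  rw [integral_eq_zero_of_ae hzero] at hone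
  exact zero_ne_one hone

theorem hasSubgaussianMarginals_randomColumn_of_entrySupNorm_eq [Fintype m]
    (hX : ∀ k t, Measurable fun ω => X ω k t)
    (hind : iIndepFun (fun (p : m × n) ω => X ω p.1 p.2) P) (h0 : ∀ k t, ∫ ω, X ω k t ∂P = 0)
    {S : ℝ} {N : ℕ} (hS : entrySupNorm P X = ENNReal.ofReal (S / √(N : ℝ))) (t : n) :
    HasSubgaussianMarginals (randomColumn X t) (‖S‖₊ ^ 2 / N) P := by
  have hM : entrySupNorm P X ≤ (‖S‖₊ / NNReal.sqrt N : NNReal) := by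
    rw [hS, ENNReal.ofReal, ENNReal.coe_le_coe, Real.toNNReal_le_iff_le_coe]
    push_cast
    gcongr
    exact le_abs_self S
  rw [← NNReal.sq_sqrt (N : NNReal), ← div_pow]
  exact hasSubgaussianMarginals_randomColumn hX hind h0 (ae_norm_le_of_entrySupNorm_le hM) t

end EntrySupNorm

/-- Exponential concentration of data. The norm `‖·‖` of a matrix is the Frobenius norm. -/
theorem proposition1 :
    ∃ C : ℝ, 0 < C ∧
      ∀ (K T : ℕ), 1 ≤ K →
      ∀ {Ω : Type*} [MeasurableSpace Ω] (P : Measure Ω) [IsProbabilityMeasure P]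
        (X : Ω → Matrix (Fin K) (Fin T) ℂ) (S : ℝ),
        (∀ k t, Measurable (fun ω => X ω k t)) →
        iIndepFun (fun (p : Fin K × Fin T) (ω : Ω) => X ω p.1 p.2) P →
        (∀ k t, ∫ ω, X ω k t ∂P = 0) →
        entrySupNorm P X = ENNReal.ofReal (S / √(T : ℝ)) →
        matrixExpectation P (fun ω => X ω * (X ω)ᴴ) = 1 →
        ∀ δ : ℝ, 0 < δ → C ^ 2 * (K : ℝ) / δ ^ 2 ≤ (T : ℝ) →
          P.real {ω | 1 / Real.log 2 * S ^ 2 * max δ (δ ^ 2)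
              ≤ ‖X ω * (X ω)ᴴ - 1‖ / √(K : ℝ)}
            < 2 * Real.exp (-((δ * √(T : ℝ) / C - √(K : ℝ)) ^ 2)) := by
  refine ⟨512, by norm_num, fun K T hK Ω _ P _ X S hX hind h0 hS hE δ hδ hT => ?_⟩
  have : Nonempty (Fin K) := Fin.pos_iff_nonempty.1 hK
  have hS0 : ‖S‖₊ ≠ 0 := by
    intro hzero
    exact entrySupNorm_ne_zero_of_matrixExpectation_eq_one hE (by simp_all)
  simpa [hE] using proposition1_general hX (iIndepFun_randomColumn hX hind) hS0
    (by simpa using hasSubgaussianMarginals_randomColumn_of_entrySupNorm_eq hX hind h0 hS) hδ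
    (by simpa using hT)
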